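/- Let $(\Omega,\mathcal F,P)$ be a complete probability space, let $\mathcal X\subset\mathbb R$ be countably infinite, and for each $x\in\mathcal X$ let $\mathcal Y_x\subseteq\mathbb R$ be a random closed set, i.e. a random variable on $(\Omega,\mathcal F,P)$ with values in the space of closed subsets of $\mathbb R$ equipped with the Borel $\sigma$-algebra of the Fell topology, such that $P[\mathcal Y_x=\emptyset]=0$. Let $\mathcal I:=\{f:\mathbb R\to\mathbb R\mid f(x)\in\mathcal Y_x\text{ for all }x\in\mathcal X\}$ be the (random) set of interpolating functions. If $\mathcal X$ is locally finite, i.e. $\mathcal X\cap[a,b]$ is finite for all real $a,b$, then the set $A:=\{\exists f\in\mathcal I:\ f\text{ is real analytic on }\mathbb R\}\subseteq\Omega$ is an event, i.e. $A\in\mathcal F$, and $P[A]=1$. -/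

import Mathlib

open MeasureTheory TopologicalSpace

/-- The Fell topology on the space of closed subsets of `E`: the topology generated by the
families `{F | F ∩ G ≠ ∅}` with `G` open and `{F | F ∩ K = ∅}` with `K` compact. It is kept as a
plain definition, since other topologies on `Closeds E` are in use. -/
def fellTopology (E : Type*) [TopologicalSpace E] : TopologicalSpace (Closeds E) :=
  TopologicalSpace.generateFrom
    ({U | ∃ G : Set E, IsOpen G ∧ U = {F : Closeds E | ((F : Set E) ∩ G).Nonempty}} ∪
     {U | ∃ K : Set E, IsCompact K ∧ U = {F : Closeds E | (F : Set E) ∩ K = ∅}})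

/-- The Borel sigma-algebra of the Fell topology. -/
def fellBorel (E : Type*) [TopologicalSpace E] : MeasurableSpace (Closeds E) :=
  @borel (Closeds E) (fellTopology E)

/-- A random closed set in `E`: a random variable with values in the closed subsets of `E`, with
respect to the Borel sigma-algebra of the Fell topology. -/
def IsRandomClosedSet {Ω E : Type*} [MeasurableSpace Ω] [TopologicalSpace E]
    (Y : Ω → Closeds E) : Prop :=
  @Measurable Ω (Closeds E) _ (fellBorel E) Y

/-- A set of reals is locally finite if every bounded interval contains only finitely many of its
points. -/
def IsLocallyFiniteSet (X : Set ℝ) : Prop :=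
  ∀ a b : ℝ, (X ∩ Set.Icc a b).Finite

/-- The perforated plane: all `(x, y)` such that `y ∈ Y x` whenever `x ∈ X`. -/
def perforatedPlane (X : Set ℝ) (Y : X → Closeds ℝ) : Set (ℝ × ℝ) :=
  {p | ∀ h : p.1 ∈ X, p.2 ∈ Y ⟨p.1, h⟩}

/-- The interpolating functions: those whose graph is contained in the perforated plane. -/
def interpolants (X : Set ℝ) (Y : X → Closeds ℝ) : Set (ℝ → ℝ) :=
  {f | ∀ x : ℝ, (x, f x) ∈ perforatedPlane X Y}

theorem mem_interpolants_iff (X : Set ℝ) (Y : X → Closeds ℝ) (f : ℝ → ℝ) :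
    f ∈ interpolants X Y ↔ ∀ x : X, f x ∈ Y x :=
  ⟨fun h x => h x x.2, fun h x hx => h ⟨x, hx⟩⟩

/-- The event that some interpolating function is real analytic on all of `ℝ`. -/
def analyticEvent {Ω : Type*} (X : Set ℝ) (Y : X → Ω → Closeds ℝ) : Set Ω :=
  {ω | ∃ f ∈ interpolants X (fun x => Y x ω), AnalyticOnNhd ℝ f Set.univ}

open Filter Topology

/-! Off a countable union of null events every `Y x ω` is nonempty, so values can be chosen there
for each `ω` separately. Measurability of the choice is irrelevant: the complement of the event lies
in a null set and `P` is complete. What remains is deterministic, a Mittag-Leffler type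
construction: correct polynomials successively at the new nodes without disturbing the old ones, by
at most `(1 / 2) ^ n` on the disc of radius `n`. Control on complex discs, not just real intervals,
makes the limit entire. -/

/-- A polynomial that vanishes on the nodes in `S`, takes prescribed values at the nodes in `T`
outside the disc of radius `r`, and is small on that disc. -/
theorem exists_polynomial_interpolating_small (S T : Finset ℝ) (hST : Disjoint S T) {r : ℝ}
    (hr : 0 ≤ r) (hT : ∀ t ∈ T, r < |t|) (v : ℝ → ℂ) {ε : ℝ} (hε : 0 < ε) :
    ∃ p : Polynomial ℂ, (∀ s ∈ S, p.eval (s : ℂ) = 0) ∧ (∀ t ∈ T, p.eval (t : ℂ) = v t) ∧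
      ∀ z : ℂ, ‖z‖ ≤ r → ‖p.eval z‖ ≤ ε := by
  have hinj : Set.InjOn (fun x : ℝ => (x : ℂ)) (S ∪ T : Finset ℝ) :=
    Complex.ofReal_injective.injOn
  let b : ℝ → Polynomial ℂ := Lagrange.basis (S ∪ T) (fun x : ℝ => (x : ℂ))
  -- The `+ 1` covers empty `T`.
  have hδ : 0 < ε / (T.card + 1) := by positivity
  -- The factor `(z / t) ^ m` is 1 at `t` and decays geometrically in `m` on the disc, as `r < |t|`.
  have key : ∀ t : ℝ, ∃ m : ℕ, t ∈ T →
      ∀ z : ℂ, ‖z‖ ≤ r → ‖v t * (b t).eval z * (z / t) ^ m‖ ≤ ε / (T.card + 1) := by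
    intro t
    by_cases ht : t ∈ T
    swap
    · exact ⟨0, fun h => absurd h ht⟩
    obtain ⟨C, hC⟩ := (isCompact_closedBall (0 : ℂ) r).exists_bound_of_continuousOn
      (f := fun z => v t * (b t).eval z) (by fun_prop)
    have ht0 : 0 < |t| := hr.trans_lt (hT t ht)
    have hlim : Tendsto (fun m : ℕ => C * (r / |t|) ^ m) atTop (𝓝 (C * 0)) :=
      (tendsto_pow_atTop_nhds_zero_of_lt_one (by positivity)
        ((div_lt_one ht0).2 (hT t ht))).const_mul C
    rw [mul_zero] at hlim
    obtain ⟨m, hm⟩ := (hlim.eventually_lt_const hδ).exists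
    refine ⟨m, fun _ z hz => ?_⟩
    have hCz := hC z (by simpa using hz)
    rw [norm_mul, norm_pow, norm_div, Complex.norm_real, Real.norm_eq_abs]
    refine le_trans ?_ hm.le
    have := (norm_nonneg _).trans hCz
    gcongr
  choose m hm using key
  have heval : ∀ z : ℂ, (∑ t ∈ T, Polynomial.C (v t) * b t *
      (Polynomial.C ((t : ℂ)⁻¹) * Polynomial.X) ^ m t).eval z =
        ∑ t ∈ T, v t * (b t).eval z * (z / t) ^ m t := by
    intro z
    simp [Polynomial.eval_finsetSum, div_eq_inv_mul]
  refine ⟨∑ t ∈ T, Polynomial.C (v t) * b t *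
    (Polynomial.C ((t : ℂ)⁻¹) * Polynomial.X) ^ m t, ?_, ?_, ?_⟩
  · intro s hs
    rw [heval]
    refine Finset.sum_eq_zero fun t ht => ?_
    have hne : t ≠ s := fun h => Finset.disjoint_left.1 hST hs (h ▸ ht)
    have : (b t).eval (s : ℂ) = 0 :=
      Lagrange.eval_basis_of_ne (v := fun x : ℝ => (x : ℂ)) hne (Finset.mem_union_left _ hs)
    simp [this]
  · intro t ht
    rw [heval, Finset.sum_eq_single_of_mem t ht]
    · have hself : (b t).eval (t : ℂ) = 1 :=
        Lagrange.eval_basis_self hinj (Finset.mem_union_right _ ht)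
      have ht0 : (t : ℂ) ≠ 0 := by
        have := hr.trans_lt (hT t ht)
        simpa using this
      simp [hself, ht0]
    · intro u _ hu
      have : (b u).eval (t : ℂ) = 0 :=
        Lagrange.eval_basis_of_ne (v := fun x : ℝ => (x : ℂ)) hu (Finset.mem_union_right _ ht)
      simp [this]
  · intro z hz
    rw [heval]
    calc ‖∑ t ∈ T, v t * (b t).eval z * (z / t) ^ m t‖
        ≤ ∑ _t ∈ T, ε / (T.card + 1) := norm_sum_le_of_le _ fun t ht => hm t ht z hz
      _ = ε * (T.card / (T.card + 1)) := by rw [Finset.sum_const, nsmul_eq_mul]; ring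
      _ ≤ ε * 1 := by
          gcongr
          exact (div_le_one (by positivity)).2 (by linarith)
      _ = ε := mul_one ε

/-- Polynomials interpolating on growing intervals, with geometrically small increments. -/
theorem IsLocallyFiniteSet.exists_polynomial_seq {X : Set ℝ} (hX : IsLocallyFiniteSet X)
    (c : ℝ → ℝ) : ∃ p : ℕ → Polynomial ℂ,
      (∀ n : ℕ, ∀ x ∈ X, |x| ≤ n → (p n).eval (x : ℂ) = c x) ∧
      ∀ n : ℕ, ∀ z : ℂ, ‖z‖ ≤ n → ‖(p (n + 1)).eval z - (p n).eval z‖ ≤ (1 / 2) ^ n := by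
  have step : ∀ (n : ℕ) (q : Polynomial ℂ), ∃ q' : Polynomial ℂ,
      (∀ x ∈ X, |x| ≤ n → q'.eval (x : ℂ) = q.eval (x : ℂ)) ∧
      (∀ x ∈ X, n < |x| → |x| ≤ n + 1 → q'.eval (x : ℂ) = c x) ∧
      ∀ z : ℂ, ‖z‖ ≤ n → ‖q'.eval z - q.eval z‖ ≤ (1 / 2) ^ n := by
    intro n q
    have hfin := hX (-(n + 1)) (n + 1)
    have hmem : ∀ x : ℝ, x ∈ hfin.toFinset ↔ x ∈ X ∧ |x| ≤ n + 1 := by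
      intro x
      simp [abs_le]
    obtain ⟨p, h₀, hv, hsmall⟩ := exists_polynomial_interpolating_small
      (hfin.toFinset.filter fun x => |x| ≤ n) (hfin.toFinset.filter fun x => ¬ |x| ≤ n)
      (Finset.disjoint_filter_filter_not _ _ _) (Nat.cast_nonneg n)
      (fun t ht => not_le.1 (Finset.mem_filter.1 ht).2)
      (fun x => c x - q.eval (x : ℂ)) (ε := (1 / 2) ^ n) (by positivity)
    refine ⟨q + p, fun x hx hxn => ?_, fun x hx hxn hxn' => ?_, fun z hz => ?_⟩
    · rw [Polynomial.eval_add, h₀ x, add_zero]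
      exact Finset.mem_filter.2 ⟨(hmem x).2 ⟨hx, by linarith⟩, hxn⟩
    · rw [Polynomial.eval_add, hv x, add_sub_cancel]
      exact Finset.mem_filter.2 ⟨(hmem x).2 ⟨hx, hxn'⟩, not_le.2 hxn⟩
    · simpa using hsmall z hz
  choose next hold hnew hsmall using step
  -- At stage 0 the only possible node is 0, so a constant suffices.
  let p : ℕ → Polynomial ℂ := fun n => Nat.rec (Polynomial.C (c 0 : ℂ)) next n
  have hp : ∀ n, p (n + 1) = next n (p n) := fun _ => rfl
  refine ⟨p, fun n => ?_, fun n z hz => hp n ▸ hsmall n (p n) z hz⟩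
  induction n with
  | zero =>
    intro x _ hx
    have : x = 0 := abs_nonpos_iff.1 (by simpa using hx)
    simp [p, this]
  | succ n ih =>
    intro x hx hxn
    rw [hp]
    rcases le_or_gt |x| n with h | h
    · rw [hold n _ x hx h, ih x hx h]
    · exact hnew n _ x hx h (by exact_mod_cast hxn)

/-- Arbitrary values on a locally finite set of reals are interpolated by an entire function. -/
theorem IsLocallyFiniteSet.exists_entire_interpolation {X : Set ℝ} (hX : IsLocallyFiniteSet X)
    (c : ℝ → ℝ) : ∃ F : ℂ → ℂ, Differentiable ℂ F ∧ ∀ x ∈ X, F x = c x := by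
  obtain ⟨p, hval, hincr⟩ := hX.exists_polynomial_seq c
  -- On the disc of radius `N` the increments are controlled only from index `N` on.
  have hshift : ∀ (N : ℕ) (z : ℂ), ‖z‖ ≤ N → ∀ n,
      dist ((p (n + N)).eval z) ((p (n + 1 + N)).eval z) ≤ (1 / 2 : ℝ) ^ N * (1 / 2) ^ n := by
    intro N z hz n
    rw [dist_comm, dist_eq_norm, ← pow_add, add_comm N n, add_right_comm]
    refine hincr (n + N) z (hz.trans ?_)
    push_cast
    linarith [(Nat.cast_nonneg n : (0 : ℝ) ≤ n)]
  have hlim : ∀ z : ℂ, ∃ w, Tendsto (fun n => (p n).eval z) atTop (𝓝 w) := by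
    intro z
    obtain ⟨N, hN⟩ := exists_nat_ge ‖z‖
    obtain ⟨w, hw⟩ := cauchySeq_tendsto_of_complete
      (cauchySeq_of_le_geometric _ _ (by norm_num) (hshift N z hN))
    exact ⟨w, (tendsto_add_atTop_iff_nat N).1 hw⟩
  choose F hF using hlim
  have hdist : ∀ (N : ℕ) (z : ℂ), ‖z‖ ≤ N →
      dist ((p N).eval z) (F z) ≤ 2 * (1 / 2 : ℝ) ^ N := by
    intro N z hz
    have h := dist_le_of_le_geometric_of_tendsto₀ _ _ (by norm_num) (hshift N z hz)
      ((tendsto_add_atTop_iff_nat N).2 (hF z))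
    rw [zero_add] at h
    exact h.trans_eq (by ring)
  have hunif : TendstoLocallyUniformlyOn (fun n z => (p n).eval z) F atTop Set.univ := by
    rw [tendstoLocallyUniformlyOn_iff_forall_isCompact isOpen_univ]
    intro K _ hK
    obtain ⟨R, hR⟩ := hK.isBounded.exists_norm_le
    rw [Metric.tendstoUniformlyOn_iff]
    intro ε hε
    have h0 : Tendsto (fun n : ℕ => 2 * (1 / 2 : ℝ) ^ n) atTop (𝓝 (2 * 0)) :=
      (tendsto_pow_atTop_nhds_zero_of_lt_one (by norm_num) (by norm_num)).const_mul 2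
    rw [mul_zero] at h0
    filter_upwards [h0.eventually_lt_const hε,
      tendsto_natCast_atTop_atTop.eventually_ge_atTop R] with n hn hRn z hz
    rw [dist_comm]
    exact (hdist n z ((hR z hz).trans hRn)).trans_lt hn
  refine ⟨F, ?_, fun x hx => ?_⟩
  · rw [← differentiableOn_univ]
    exact hunif.differentiableOn
      (Eventually.of_forall fun n => (p n).differentiable.differentiableOn) isOpen_univ
  · refine tendsto_nhds_unique (hF x) (tendsto_const_nhds.congr' ?_)
    filter_upwards [tendsto_natCast_atTop_atTop.eventually_ge_atTop |x|] with n hn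
    exact (hval n x hx hn).symm

/-- Arbitrary values on a locally finite set of reals are interpolated by a function that is real
analytic on the whole line. -/
theorem IsLocallyFiniteSet.exists_analytic_interpolation {X : Set ℝ} (hX : IsLocallyFiniteSet X)
    (c : ℝ → ℝ) : ∃ f : ℝ → ℝ, AnalyticOnNhd ℝ f Set.univ ∧ ∀ x ∈ X, f x = c x := by
  obtain ⟨F, hF, hFc⟩ := hX.exists_entire_interpolation c
  -- `F` need not be real on `ℝ` away from the nodes; its real part keeps the real values `c x`.
  exact ⟨fun x => (F x).re, fun x _ => (hF.analyticAt (x : ℂ)).re_ofReal,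
    fun x hx => by simp [hFc x hx]⟩

theorem mem_analyticEvent_of_forall_nonempty {Ω : Type*} {X : Set ℝ} (hX : IsLocallyFiniteSet X)
    {Y : X → Ω → Closeds ℝ} {ω : Ω} (h : ∀ x, (Y x ω : Set ℝ).Nonempty) :
    ω ∈ analyticEvent X Y := by
  classical
  choose c hc using h
  obtain ⟨f, hf, hfc⟩ := hX.exists_analytic_interpolation
    (fun x => if hx : x ∈ X then c ⟨x, hx⟩ else 0)
  refine ⟨f, (mem_interpolants_iff _ _ _).2 fun x => ?_, hf⟩
  rw [hfc x x.2, dif_pos x.2]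
  exact hc x

theorem proposition5 {Ω : Type*} [MeasurableSpace Ω] (P : Measure Ω) [IsProbabilityMeasure P]
    [P.IsComplete] (X : Set ℝ) (hXcount : X.Countable) (hXinf : X.Infinite)
    (Y : X → Ω → Closeds ℝ) (hY : ∀ x, IsRandomClosedSet (Y x))
    (hne : ∀ x, P {ω | (Y x ω : Set ℝ) = ∅} = 0)
    (hX : IsLocallyFiniteSet X) :
    MeasurableSet (analyticEvent X Y) ∧ P (analyticEvent X Y) = 1 := by
  have := hXcount.to_subtype
  have hnull : P (analyticEvent X Y)ᶜ = 0 := by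
    refine measure_mono_null (fun ω hω => ?_) (measure_iUnion_null hne)
    by_contra h
    simp only [Set.mem_iUnion, Set.mem_ofPred_eq, not_exists] at h
    exact hω (mem_analyticEvent_of_forall_nonempty hX fun x =>
      Set.nonempty_iff_ne_empty.2 (h x))
  have hmeas : MeasurableSet (analyticEvent X Y) :=
    MeasurableSet.of_compl (Measure.IsComplete.out' _ hnull)
  exact ⟨hmeas, (prob_compl_eq_zero_iff hmeas).1 hnull⟩
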